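/- Let $k \ge 1$ and $n \ge 0$ be integers, put $N = k(n+1)$, and let $$\Delta(n+1,N) = \Big\{x \in [0,1]^N : \sum_{j=1}^N x_j = n+1\Big\}$$ be the hypersimplex. For $i \in \{0,\dots,n\}$ let $$P_{k,n,i} = \Big\{x \in \Delta(n+1,N) : \sum_{s=1}^{kt} x_{ki+s} \le t \ \text{ for } t = 1,\dots,n\Big\},$$ where the indices of the coordinates are taken modulo $N$. Let $A_{m,r}$ denote the Eulerian number, i.e. the number of permutations of $r$ letters with exactly $m$ descents. The normalized volume of a subset of the hyperplane $H = \{x \in \mathbb{R}^N : \sum_j x_j = n+1\}$ is $(N-1)!$ times its $(N-1)$-dimensional Euclidean volume, divided by the covolume of the lattice $\{v \in \mathbb{Z}^N : \sum_j v_j = 0\}$ in $\{v \in \mathbb{R}^N : \sum_j v_j = 0\}$ (so that unimodular lattice simplices in $H$ have normalized volume $1$). Then for every $i \in \{0,\dots,n\}$ the normalized volume of $P_{k,n,i}$ is $$\frac{1}{n+1}\, A_{n,\,kn+k-1}.$$ -/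

import Mathlib

open MeasureTheory
open scoped Nat ENNReal

noncomputable section

/-- The number of descents of a permutation `w` of `n` letters: the number of positions `i`, with
`i + 1` still a position, such that `w i > w (i + 1)`. -/
def descentCount {n : ℕ} (w : Equiv.Perm (Fin n)) : ℕ :=
  (Finset.univ.filter fun i : Fin n => ∃ h : (i : ℕ) + 1 < n, w ⟨(i : ℕ) + 1, h⟩ < w i).card

/-- The Eulerian number `A_{m,n}`: the number of permutations on `n` letters with `m` descents. -/
def eulerianNumber (m n : ℕ) : ℕ :=
  (Finset.univ.filter fun w : Equiv.Perm (Fin n) => descentCount w = m).card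

/-- The affine hyperplane of all `x ∈ ℝ^N` with `x_1 + ⋯ + x_N = c`. -/
def sumHyperplane (N : ℕ) (c : ℝ) : AffineSubspace ℝ (EuclideanSpace ℝ (Fin N)) where
  carrier := {x | ∑ j, x j = c}
  smul_vsub_vadd_mem' := by
    intro a p q r hp hq hr
    simp only [Set.mem_ofPred_eq] at hp hq hr ⊢
    simp [Finset.sum_add_distrib, ← Finset.mul_sum, hp, hq, hr]

/-- The hypersimplex `Δ(c, N)`: all `x ∈ [0,1]^N` with `x_1 + ⋯ + x_N = c`. -/
def hypersimplex (c N : ℕ) : Set (EuclideanSpace ℝ (Fin N)) :=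
  {x | (∀ j, x j ∈ Set.Icc (0 : ℝ) 1) ∧ ∑ j, x j = (c : ℝ)}

/-- The polytope `P_{k,n,i}`: all `x ∈ Δ(n+1, k(n+1))` such that
`x_{ki+1} + x_{ki+2} + ⋯ + x_{ki+kt} ≤ t` for `t = 1, …, n`, indices modulo `k(n+1)`.
Coordinates are numbered from `0` here, so that `x_{ki+s}` is the coordinate with number
`ki + s - 1`, and `Fin.ofNat` reduces this number modulo `k(n+1)`. -/
def shiftedPolytope (k n : ℕ) [NeZero k] (i : Fin (n + 1)) :
    Set (EuclideanSpace ℝ (Fin (k * (n + 1)))) :=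
  {x | x ∈ hypersimplex (n + 1) (k * (n + 1)) ∧
    ∀ t ∈ Finset.Icc 1 n,
      ∑ s ∈ Finset.range (k * t), x (Fin.ofNat (k * (n + 1)) (k * (i : ℕ) + s)) ≤ (t : ℝ)}

/-- The integer points `V ∩ ℤ^N` of a linear subspace `V` of `ℝ^N`. -/
def integerPoints {N : ℕ} (V : Submodule ℝ (EuclideanSpace ℝ (Fin N))) : Submodule ℤ V where
  carrier := {v | ∀ j, ∃ m : ℤ, (v : EuclideanSpace ℝ (Fin N)) j = m}
  add_mem' := by
    intro a b ha hb j
    obtain ⟨p, hp⟩ := ha j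
    obtain ⟨q, hq⟩ := hb j
    exact ⟨p + q, by simp [hp, hq]⟩
  zero_mem' := fun _ => ⟨0, by simp⟩
  smul_mem' := by
    intro c a ha j
    obtain ⟨p, hp⟩ := ha j
    exact ⟨c * p, by simp [hp]⟩

/-- The covolume of the lattice `V ∩ ℤ^N` in the Euclidean space `V`. -/
def integerCovolume {N : ℕ} (V : Submodule ℝ (EuclideanSpace ℝ (Fin N))) : ℝ :=
  ZLattice.covolume (integerPoints V)

/-- The normalized volume of a subset `P` of an affine subspace `A` of `ℝ^N` whose direction `V` is
spanned by integer points: with `d = dim A`, it is `d!` times the `d`-dimensional Euclidean volume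
of `P`, divided by the covolume of the lattice `V ∩ ℤ^N` in `V`. In other words, it is the volume
on `A` for which a simplex spanned by a point and a lattice basis at this point has volume `1`. -/
def normalizedVolume {N : ℕ} (A : AffineSubspace ℝ (EuclideanSpace ℝ (Fin N)))
    (P : Set (EuclideanSpace ℝ (Fin N))) : ℝ≥0∞ :=
  ((Module.finrank ℝ A.direction)! : ℝ≥0∞) * μHE[Module.finrank ℝ A.direction] P /
    ENNReal.ofReal (integerCovolume A.direction)

end

/-! Let `r = N - 1`. Dropping the coordinate `x_0` maps the hypersimplex, up to a null set, onto the
slab `⌊∑ y⌋ = n` of the unit cube of `ℝ^r`, and turns normalized volume into `r!` times Lebesgue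
measure.

The slab is measured by Stanley's argument: taking partial sums modulo 1 preserves measure on `ℝ^r /
ℤ^r`, and a partial sum passes an integer exactly where the fractional parts descend
(`tupleDescents_fract_partialSums`). So the slab is as large as the set of points of the cube with
`n` descents, which consists of `A_{n,r}` of the `r!` congruent sorting chambers.

Finally, the `n + 1` polytopes are cyclic shifts of one another, hence congruent. They cover the
hypersimplex by a cycle-lemma argument (`exists_mem_windowPolytope`) and overlap only in null sets
(`aedisjoint_windowPolytope`), so each has `1/(n+1)` of the volume. -/

/-! ### Descents of a random point of the cube -/

/-- The half-open unit cube `[0,1)^r`. -/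
def unitCube (r : ℕ) : Set (Fin r → ℝ) := Set.univ.pi fun _ => Set.Ico 0 1

lemma volume_unitCube (r : ℕ) : volume (unitCube r) = 1 := by
  simp [unitCube, Real.volume_pi_Ico]

lemma measurableSet_unitCube (r : ℕ) : MeasurableSet (unitCube r) :=
  MeasurableSet.univ_pi fun _ => measurableSet_Ico

/-- The number of descents of a tuple of real numbers. -/
noncomputable def tupleDescents {r : ℕ} (x : Fin r → ℝ) : ℕ :=
  (Finset.univ.filter fun i : Fin r => ∃ h : (i : ℕ) + 1 < r, x ⟨(i : ℕ) + 1, h⟩ < x i).card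

lemma measurable_tupleDescents (r : ℕ) : Measurable (tupleDescents (r := r)) := by
  unfold tupleDescents
  simp_rw [Finset.card_filter]
  refine Finset.measurable_sum _ fun i _ => Measurable.ite ?_ measurable_const measurable_const
  by_cases h : (i : ℕ) + 1 < r
  · simpa [h] using measurableSet_lt (measurable_pi_apply (X := fun _ : Fin r => ℝ) ⟨i + 1, h⟩)
      (measurable_pi_apply i)
  · simp [h]

/-- The points of the unit cube whose coordinates increase strictly along `σ`. -/
def sortedCube {r : ℕ} (σ : Equiv.Perm (Fin r)) : Set (Fin r → ℝ) :=
  {x | x ∈ unitCube r ∧ StrictMono (x ∘ σ)}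

lemma measurableSet_sortedCube {r : ℕ} (σ : Equiv.Perm (Fin r)) :
    MeasurableSet (sortedCube σ) := by
  refine (measurableSet_unitCube r).inter ?_
  have : {x : Fin r → ℝ | StrictMono (x ∘ σ)} =
      ⋂ i, ⋂ j, ⋂ _ : i < j, {x : Fin r → ℝ | x (σ i) < x (σ j)} := by
    ext x
    simp [StrictMono]
  change MeasurableSet {x : Fin r → ℝ | StrictMono (x ∘ σ)}
  rw [this]
  exact .iInter fun i => .iInter fun j => .iInter fun _ =>
    measurableSet_lt (measurable_pi_apply _) (measurable_pi_apply _)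

lemma volume_sortedCube_eq {r : ℕ} (σ : Equiv.Perm (Fin r)) :
    volume (sortedCube σ) = volume (sortedCube (1 : Equiv.Perm (Fin r))) := by
  have h := volume_measurePreserving_piCongrLeft (fun _ : Fin r => ℝ) σ
  rw [← h.measure_preimage_equiv]
  congr 1
  have key (x : Fin r → ℝ) (j : Fin r) :
      MeasurableEquiv.piCongrLeft (fun _ : Fin r => ℝ) σ x (σ j) = x j :=
    Equiv.piCongrLeft_apply_apply (fun _ : Fin r => ℝ) σ x j
  ext x
  simp only [sortedCube, unitCube, Set.mem_pi, Set.mem_univ, true_implies, Set.mem_preimage,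
    Set.mem_ofPred_eq, StrictMono, Function.comp_apply, key, Equiv.Perm.one_apply]
  rw [σ.surjective.forall]
  simp only [key]

lemma sortedCube_pairwise_disjoint (r : ℕ) :
    Pairwise (Function.onFun Disjoint (sortedCube (r := r))) := by
  intro σ τ hst
  refine Set.disjoint_left.2 fun x hx hy => hst ?_
  have h : x ∘ σ = x ∘ τ := by
    refine (StrictMono.range_inj hx.2 hy.2).1 ?_
    rw [Set.range_comp, Set.range_comp, σ.range_eq_univ, τ.range_eq_univ]
  have hinj : Function.Injective x := by
    have := hx.2.injective
    rwa [Equiv.injective_comp] at this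
  ext i
  exact congrArg Fin.val (hinj (congrFun h i))

lemma ae_injective (r : ℕ) : ∀ᵐ x : Fin r → ℝ, Function.Injective x := by
  have h (i j : Fin r) (hij : i ≠ j) : ∀ᵐ x : Fin r → ℝ, x i ≠ x j := by
    let f : (Fin r → ℝ) →ₗ[ℝ] ℝ :=
      (LinearMap.proj i : (Fin r → ℝ) →ₗ[ℝ] ℝ) - (LinearMap.proj j : (Fin r → ℝ) →ₗ[ℝ] ℝ)
    have : volume (LinearMap.ker f : Set (Fin r → ℝ)) = 0 := by
      refine Measure.addHaar_submodule _ _ fun htop => ?_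
      have : (Pi.single i 1 : Fin r → ℝ) ∈ LinearMap.ker f := htop ▸ Submodule.mem_top
      simp [f, hij.symm] at this
    rw [ae_iff]
    convert this using 2
    ext x
    simp [f, sub_eq_zero]
  have h' : ∀ᵐ x : Fin r → ℝ, ∀ i j, i ≠ j → x i ≠ x j := by
    rw [ae_all_iff]; intro i
    rw [ae_all_iff]; intro j
    by_cases hij : i = j
    · simp [hij]
    · simpa [hij] using h i j hij
  filter_upwards [h'] with x hx i j hij
  by_contra hne
  exact hx i j hne hij

lemma exists_mem_sortedCube {r : ℕ} {x : Fin r → ℝ} (hx : x ∈ unitCube r)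
    (hinj : Function.Injective x) : ∃ σ, x ∈ sortedCube σ :=
  ⟨Tuple.sort x, hx, (Tuple.monotone_sort x).strictMono_of_injective
    (hinj.comp (Tuple.sort x).injective)⟩

/-- The `r!` chambers are disjoint, have equal volume, and cover the cube except for points with two
equal coordinates. -/
lemma volume_sortedCube {r : ℕ} (σ : Equiv.Perm (Fin r)) :
    volume (sortedCube σ) = (r ! : ℝ≥0∞)⁻¹ := by
  have hU : (⋃ σ, sortedCube σ : Set (Fin r → ℝ)) =ᵐ[volume] unitCube r := by
    filter_upwards [ae_injective r] with x hx
    refine propext ⟨fun h => ?_, fun h => ?_⟩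
    · obtain ⟨σ, hσ⟩ := Set.mem_iUnion.1 h
      exact hσ.1
    · exact Set.mem_iUnion.2 (exists_mem_sortedCube h hx)
  have h := measure_iUnion (μ := volume) (sortedCube_pairwise_disjoint r) measurableSet_sortedCube
  rw [measure_congr hU, volume_unitCube, tsum_fintype,
    Finset.sum_congr rfl fun τ _ => (volume_sortedCube_eq τ).trans (volume_sortedCube_eq σ).symm,
    Finset.sum_const, Finset.card_univ, Fintype.card_perm, Fintype.card_fin, nsmul_eq_mul] at h
  rw [mul_comm] at h
  exact ENNReal.eq_inv_of_mul_eq_one_left h.symm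

/-- Since `σ` lists the positions by increasing value, the ranks of the values are given by `σ⁻¹`.
-/
lemma tupleDescents_of_mem_sortedCube {r : ℕ} {σ : Equiv.Perm (Fin r)} {x : Fin r → ℝ}
    (hx : x ∈ sortedCube σ) : tupleDescents x = descentCount σ⁻¹ := by
  have key (a b : Fin r) : x a < x b ↔ σ⁻¹ a < σ⁻¹ b := by
    have := hx.2.lt_iff_lt (a := σ⁻¹ a) (b := σ⁻¹ b)
    simpa using this
  simp only [tupleDescents, descentCount, key]

lemma volume_tupleDescents_eq (m r : ℕ) :
    volume ({x : Fin r → ℝ | tupleDescents x = m} ∩ unitCube r) =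
      (eulerianNumber m r : ℝ≥0∞) / (r ! : ℝ≥0∞) := by
  have hU : (⋃ σ ∈ Finset.univ.filter fun σ : Equiv.Perm (Fin r) => descentCount σ⁻¹ = m,
      sortedCube σ : Set (Fin r → ℝ)) =ᵐ[volume]
      ({x : Fin r → ℝ | tupleDescents x = m} ∩ unitCube r : Set _) := by
    filter_upwards [ae_injective r] with x hx
    refine propext ⟨fun h => ?_, fun h => ?_⟩
    · obtain ⟨σ, hσ, hxσ⟩ := Set.mem_iUnion₂.1 h
      exact ⟨(tupleDescents_of_mem_sortedCube hxσ).trans (Finset.mem_filter.1 hσ).2, hxσ.1⟩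
    · obtain ⟨σ, hσ⟩ := exists_mem_sortedCube h.2 hx
      refine Set.mem_iUnion₂.2 ⟨σ, Finset.mem_filter.2 ⟨Finset.mem_univ _, ?_⟩, hσ⟩
      exact (tupleDescents_of_mem_sortedCube hσ).symm.trans h.1
  rw [← measure_congr hU, measure_biUnion_finset
    (fun σ _ τ _ h => sortedCube_pairwise_disjoint r h) fun σ _ => measurableSet_sortedCube σ]
  simp only [volume_sortedCube, Finset.sum_const, nsmul_eq_mul, div_eq_mul_inv]
  congr 2
  refine Finset.card_bij (fun σ _ => σ⁻¹) ?_ ?_ ?_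
  · simp
  · simp
  · intro σ hσ
    exact ⟨σ⁻¹, by simpa using hσ, by simp⟩

/-! ### Partial sums modulo 1 and slabs of the cube -/

/-- The partial sums of a tuple, as a linear map. -/
def partialSums (r : ℕ) : (Fin r → ℝ) →ₗ[ℝ] (Fin r → ℝ) :=
  LinearMap.pi fun i => ∑ j ∈ Finset.Iic i, LinearMap.proj j

lemma partialSums_apply {r : ℕ} (y : Fin r → ℝ) (i : Fin r) :
    partialSums r y i = ∑ j ∈ Finset.Iic i, y j := by
  simp [partialSums]

lemma det_partialSums (r : ℕ) : LinearMap.det (partialSums r) = 1 := by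
  rw [← LinearMap.det_toMatrix']
  rw [Matrix.det_of_isLowerTriangular]
  · simp [LinearMap.toMatrix'_apply, partialSums_apply]
  · intro i j hij
    have : j ∉ Finset.Iic i := by simpa using hij
    rw [LinearMap.toMatrix'_apply, partialSums_apply]
    refine Finset.sum_eq_zero fun l hl => ?_
    have : l ≠ j := by rintro rfl; exact this hl
    simp [this]

lemma measurePreserving_partialSums (r : ℕ) : MeasurePreserving (partialSums r) := by
  refine ⟨(partialSums r).continuous_of_finiteDimensional.measurable, ?_⟩
  rw [Real.map_linearMap_volume_pi_eq_smul_volume_pi (by simp [det_partialSums])]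
  simp [det_partialSums]

/-- The partial sums of a tuple, as a linear equivalence. -/
noncomputable def partialSumsEquiv (r : ℕ) : (Fin r → ℝ) ≃ₗ[ℝ] (Fin r → ℝ) :=
  (partialSums r).equivOfDetNeZero (by simp [det_partialSums])

lemma partialSumsEquiv_apply {r : ℕ} (y : Fin r → ℝ) :
    partialSumsEquiv r y = partialSums r y := rfl

/-- Each entry is a difference of consecutive partial sums. With `S = ℤ` this says that
`partialSums` maps the lattice `ℤ^r` onto itself. -/
lemma partialSums_mem_iff {r : ℕ} (S : AddSubgroup ℝ) (y : Fin r → ℝ) :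
    (∀ i, partialSums r y i ∈ S) ↔ ∀ i, y i ∈ S := by
  refine ⟨fun h i => ?_, fun h i => ?_⟩
  · induction i using WellFoundedLT.induction with
    | ind i ih =>
      have hi := h i
      rw [partialSums_apply, ← Finset.Iio_insert, Finset.sum_insert (by simp)] at hi
      exact (S.add_mem_cancel_right (S.sum_mem fun j hj => ih j (Finset.mem_Iio.1 hj))).1 hi
  · rw [partialSums_apply]
    exact S.sum_mem fun j _ => h j

/-- A step of length less than 1 lowers the fractional part exactly when it reaches or passes an
integer, and it can do so only once. -/
lemma fract_add_lt_iff {a t : ℝ} (h0 : 0 ≤ t) (h1 : t < 1) :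
    (if Int.fract (a + t) < Int.fract a then 1 else 0 : ℤ) = ⌊a + t⌋ - ⌊a⌋ := by
  have ha := Int.floor_le a
  have ha' := Int.lt_floor_add_one a
  have h : ⌊a + t⌋ = ⌊a⌋ ∨ ⌊a + t⌋ = ⌊a⌋ + 1 := by
    rcases lt_or_ge (a + t) (⌊a⌋ + 1) with h | h
    · left; rw [Int.floor_eq_iff]; constructor <;> linarith
    · right; rw [Int.floor_eq_iff]; push_cast; constructor <;> linarith
  rcases h with h | h
  · rw [if_neg (by simp only [Int.fract, h]; linarith), h, sub_self]
  · rw [if_pos (by simp only [Int.fract, h]; push_cast; linarith), h, add_sub_cancel_left]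

/-- Each descent marks an integer passed between consecutive partial sums; the count telescopes to
the floor of the total. -/
lemma tupleDescents_fract_partialSums {r : ℕ} {y : Fin r → ℝ} (hy : y ∈ unitCube r) :
    (tupleDescents (fun i => Int.fract (partialSums r y i)) : ℤ) = ⌊∑ i, y i⌋ := by
  -- Extension by zero: the last position, which is never a descent, then contributes a zero floor
  -- difference.
  let f : ℕ → ℝ := fun j => if h : j < r then y ⟨j, h⟩ else 0
  have hf (j : ℕ) : 0 ≤ f j ∧ f j < 1 := by
    by_cases h : j < r
    · simpa [f, h] using hy ⟨j, h⟩ trivial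
    · simp [f, h]
  have hfi (j : Fin r) : y j = f j := by simp [f]
  let G : ℕ → ℝ := fun j => ∑ l ∈ Finset.range j, f l
  have hG (j : ℕ) : G (j + 1) = G j + f j := Finset.sum_range_succ _ _
  have hT (i : Fin r) : partialSums r y i = G (i + 1) := by
    rw [partialSums_apply]
    simp only [hfi, G]
    refine Finset.sum_bij (fun j _ => (j : ℕ)) ?_ ?_ ?_ ?_
    · intro a ha
      have : a ≤ i := by simpa using ha
      simp only [Finset.mem_range]
      have := Fin.le_def.1 this
      omega
    · intro a _ b _ h
      exact Fin.ext h
    · intro b hb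
      have hb := Finset.mem_range.1 hb
      exact ⟨⟨b, by omega⟩, by simp only [Finset.mem_Iic, Fin.le_def]; omega, rfl⟩
    · simp
  have hsum : ∑ i, y i = G r := by
    simp only [hfi, G]
    exact (Finset.sum_range f).symm
  have hterm (i : Fin r) : (if (∃ h : (i : ℕ) + 1 < r,
      Int.fract (partialSums r y ⟨(i : ℕ) + 1, h⟩) < Int.fract (partialSums r y i))
      then 1 else 0 : ℤ) = ⌊G (i + 2)⌋ - ⌊G (i + 1)⌋ := by
    rw [show (i : ℕ) + 2 = (i + 1) + 1 from rfl, hG, ← fract_add_lt_iff (hf _).1 (hf _).2, ← hG]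
    by_cases h : (i : ℕ) + 1 < r
    · simp only [hT, h, exists_true_left]
    · have : f (i + 1) = 0 := by simp [f, h]
      simp [h, hG (i + 1), this]
  rw [hsum]
  simp only [tupleDescents, Finset.card_filter]
  push_cast
  rw [Finset.sum_congr rfl fun i _ => hterm i,
    Fin.sum_univ_eq_sum_range (fun i => ⌊G (i + 2)⌋ - ⌊G (i + 1)⌋),
    Finset.sum_range_sub (fun i => ⌊G (i + 1)⌋)]
  have h1 : ⌊G (0 + 1)⌋ = 0 := by
    rw [Int.floor_eq_zero_iff, hG]
    simpa [G] using hf 0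
  have h2 : f r = 0 := by simp [f]
  rw [h1, hG, h2]
  simp

lemma mem_span_basis_iff {ι E : Type*} [Fintype ι] [NormedAddCommGroup E] [NormedSpace ℝ E]
    (e : E ≃ₗ[ℝ] (ι → ℝ)) (v : E) :
    v ∈ Submodule.span ℤ (Set.range (Module.Basis.ofEquivFun e)) ↔
      ∀ i, e v i ∈ (Int.castAddHom ℝ).range := by
  rw [Module.Basis.mem_span_iff_repr_mem]
  rfl

/-- The cube and its preimage under `partialSums` are both fundamental domains of `ℤ^r`, so the
`ℤ^r`-invariant set `A` has the same measure in each. In the cube it is the slab; in the preimage it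
is the pullback of the descent condition. -/
lemma volume_slab_inter_unitCube (m r : ℕ) :
    volume ({y : Fin r → ℝ | ⌊∑ i, y i⌋ = m} ∩ unitCube r) =
      (eulerianNumber m r : ℝ≥0∞) / (r ! : ℝ≥0∞) := by
  let b := Module.Basis.ofEquivFun (LinearEquiv.refl ℝ (Fin r → ℝ))
  let b' := Module.Basis.ofEquivFun (partialSumsEquiv r)
  have hspan : Submodule.span ℤ (Set.range b') = Submodule.span ℤ (Set.range b) := by
    ext v
    rw [mem_span_basis_iff, mem_span_basis_iff]
    exact partialSums_mem_iff _ v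
  have hb : ZSpan.fundamentalDomain b = unitCube r := by
    ext x; simp [b, unitCube]
  have hb' : ZSpan.fundamentalDomain b' = partialSums r ⁻¹' unitCube r := by
    ext x; simp [b', unitCube, partialSumsEquiv_apply]
  have h1 := ZSpan.isAddFundamentalDomain b volume
  have h2 := ZSpan.isAddFundamentalDomain b' volume
  rw [hspan, hb'] at h2
  rw [hb] at h1
  let A : Set (Fin r → ℝ) := {y | tupleDescents (fun i => Int.fract (partialSums r y i)) = m}
  have hmeas : Measurable fun y : Fin r → ℝ => fun i => Int.fract (partialSums r y i) :=
    measurable_pi_lambda _ fun i => measurable_fract.comp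
      ((measurable_pi_apply i).comp (measurePreserving_partialSums r).measurable)
  have hA : MeasurableSet A :=
    ((measurable_tupleDescents r).comp hmeas) (measurableSet_singleton m)
  have hinv (g : Submodule.span ℤ (Set.range b)) : (fun x => g +ᵥ x) ⁻¹' A = A := by
    have hg := (partialSums_mem_iff _ (g : Fin r → ℝ)).2 ((mem_span_basis_iff _ _).1 g.2)
    ext y
    have : (fun i => Int.fract (partialSums r (g +ᵥ y) i)) =
        fun i => Int.fract (partialSums r y i) := by
      funext i
      obtain ⟨z, hz⟩ := hg i
      have : partialSums r (g +ᵥ y) i = z + partialSums r y i := by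
        rw [Submodule.vadd_def, vadd_eq_add, map_add, Pi.add_apply, ← hz]; rfl
      rw [this, Int.fract_intCast_add]
    simp only [A, Set.mem_preimage, Set.mem_ofPred_eq, this]
  have : VAddInvariantMeasure (Submodule.span ℤ (Set.range b)) (Fin r → ℝ) volume :=
    inferInstanceAs <| VAddInvariantMeasure (Submodule.span ℤ (Set.range b)).toAddSubgroup _ _
  have key := h1.measure_set_eq h2 hA hinv
  have e1 : {y : Fin r → ℝ | ⌊∑ i, y i⌋ = m} ∩ unitCube r = A ∩ unitCube r := by
    ext y
    simp only [A, Set.mem_inter_iff, Set.mem_ofPred_eq]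
    refine and_congr_left fun hy => ?_
    rw [← tupleDescents_fract_partialSums hy, Nat.cast_inj]
  have e2 : A ∩ partialSums r ⁻¹' unitCube r =
      partialSums r ⁻¹' ({x : Fin r → ℝ | tupleDescents x = m} ∩ unitCube r) := by
    ext y
    simp only [A, Set.mem_inter_iff, Set.mem_ofPred_eq, Set.mem_preimage]
    refine and_congr_left fun hy => ?_
    have : (fun i => Int.fract (partialSums r y i)) = partialSums r y :=
      funext fun i => Int.fract_eq_self.2 (hy i trivial)
    rw [this]
  rw [e1, key, e2, (measurePreserving_partialSums r).measure_preimage, volume_tupleDescents_eq]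
  exact (((measurable_tupleDescents r) (measurableSet_singleton m)).inter
    (measurableSet_unitCube r)).nullMeasurableSet

/-! ### Normalized volume on the hyperplane in coordinates -/

lemma mem_sumHyperplane {N : ℕ} {c : ℝ} {x : EuclideanSpace ℝ (Fin N)} :
    x ∈ sumHyperplane N c ↔ ∑ j, x j = c := Iff.rfl

/-- The parametrization of the hyperplane `x_0 + ⋯ + x_r = c` by the last `r` coordinates. -/
def hyperplanePoint {r : ℕ} (c : ℝ) (y : Fin r → ℝ) : EuclideanSpace ℝ (Fin (r + 1)) :=
  WithLp.toLp 2 (Fin.cons (c - ∑ i, y i) y)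

@[simp] lemma hyperplanePoint_zero {r : ℕ} (c : ℝ) (y : Fin r → ℝ) :
    hyperplanePoint c y 0 = c - ∑ i, y i := rfl

@[simp] lemma hyperplanePoint_succ {r : ℕ} (c : ℝ) (y : Fin r → ℝ) (j : Fin r) :
    hyperplanePoint c y j.succ = y j := rfl

lemma hyperplanePoint_mem {r : ℕ} (c : ℝ) (y : Fin r → ℝ) :
    hyperplanePoint c y ∈ sumHyperplane (r + 1) c := by
  simp [mem_sumHyperplane, Fin.sum_univ_succ]

lemma mem_direction_sumHyperplane {r : ℕ} {c : ℝ} {v : EuclideanSpace ℝ (Fin (r + 1))} :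
    v ∈ (sumHyperplane (r + 1) c).direction ↔ ∑ j, v j = 0 := by
  have h := hyperplanePoint_mem c (0 : Fin r → ℝ)
  rw [← AffineSubspace.vadd_mem_iff_mem_direction v h, mem_sumHyperplane]
  rw [mem_sumHyperplane] at h
  simp [Finset.sum_add_distrib, h]

/-- The last `r` coordinates, as coordinates on the direction of the hyperplane
`x_0 + ⋯ + x_r = c`. -/
def directionCoords (r : ℕ) (c : ℝ) : (sumHyperplane (r + 1) c).direction ≃ₗ[ℝ] (Fin r → ℝ) where
  toFun v := fun j => (v : EuclideanSpace ℝ (Fin (r + 1))) j.succ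
  map_add' _ _ := rfl
  map_smul' _ _ := rfl
  invFun y := ⟨hyperplanePoint 0 y, mem_direction_sumHyperplane.2
    (mem_sumHyperplane.1 (hyperplanePoint_mem 0 y))⟩
  left_inv v := by
    have hv := mem_direction_sumHyperplane.1 v.2
    rw [Fin.sum_univ_succ] at hv
    ext j
    refine Fin.cases ?_ (fun j => ?_) j
    · simp only [hyperplanePoint_zero]
      linarith
    · simp
  right_inv y := by
    funext j
    simp

lemma finrank_direction_sumHyperplane (r : ℕ) (c : ℝ) :
    Module.finrank ℝ (sumHyperplane (r + 1) c).direction = r := by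
  simpa using (directionCoords r c).finrank_eq

lemma mem_integerPoints_iff {r : ℕ} {c : ℝ} (v : (sumHyperplane (r + 1) c).direction) :
    v ∈ integerPoints (sumHyperplane (r + 1) c).direction ↔
      ∀ i, directionCoords r c v i ∈ (Int.castAddHom ℝ).range := by
  constructor
  · intro h i
    obtain ⟨m, hm⟩ := h i.succ
    exact ⟨m, hm.symm⟩
  · intro h
    have hv := mem_direction_sumHyperplane.1 v.2
    rw [Fin.sum_univ_succ] at hv
    intro j
    refine Fin.cases ?_ (fun j => ?_) j
    · have hmem : (v : EuclideanSpace ℝ (Fin (r + 1))) 0 ∈ (Int.castAddHom ℝ).range := by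
        rw [eq_neg_of_add_eq_zero_left hv]
        exact neg_mem (sum_mem fun i _ => h i)
      obtain ⟨m, hm⟩ := hmem
      exact ⟨m, hm.symm⟩
    · obtain ⟨m, hm⟩ := h j
      exact ⟨m, hm.symm⟩

/-- The parametrization of the hyperplane multiplies volumes by the covolume. -/
lemma integerCovolume_direction_ne_zero_and_volume_eq (r : ℕ) (c : ℝ) :
    integerCovolume (sumHyperplane (r + 1) c).direction ≠ 0 ∧
      0 ≤ integerCovolume (sumHyperplane (r + 1) c).direction ∧
      ∀ S : Set (sumHyperplane (r + 1) c).direction, volume S =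
        ENNReal.ofReal (integerCovolume (sumHyperplane (r + 1) c).direction) *
          volume ((directionCoords r c).symm ⁻¹' S) := by
  let V := (sumHyperplane (r + 1) c).direction
  let e : (Fin r → ℝ) ≃L[ℝ] V := (directionCoords r c).symm.toContinuousLinearEquiv
  let b := Module.Basis.ofEquivFun (directionCoords r c)
  have hspan : integerPoints V = Submodule.span ℤ (Set.range b) := by
    ext v
    rw [mem_span_basis_iff, mem_integerPoints_iff]
  have hcov : integerCovolume V = volume.real (ZSpan.fundamentalDomain b) := by
    unfold integerCovolume
    rw [hspan]
    exact ZLattice.covolume_eq_measure_fundamentalDomain _ _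
      (ZSpan.isAddFundamentalDomain b volume)
  have hne : integerCovolume V ≠ 0 := by
    unfold integerCovolume
    rw [hspan]
    exact ZLattice.covolume_ne_zero _ _
  have hmap (S : Set V) : volume.map e S = volume (e ⁻¹' S) :=
    e.toHomeomorph.toMeasurableEquiv.map_apply S
  have hdom : e ⁻¹' ZSpan.fundamentalDomain b = unitCube r := by
    ext y
    simp [b, e, unitCube]
  have : (volume.map e : Measure V).IsAddHaarMeasure := e.isAddHaarMeasure_map volume
  -- Uniqueness of Haar measure leaves one unknown factor; the fundamental domain, whose preimage is
  -- the unit cube, identifies it as the covolume.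
  have hsmul := Measure.isAddLeftInvariant_eq_smul (volume : Measure V) (volume.map e)
  set a := Measure.addHaarScalarFactor (volume : Measure V) (volume.map e)
  have hS (S : Set V) : volume S = a * volume (e ⁻¹' S) := by
    rw [← hmap]
    exact congrArg (fun μ : Measure V => μ S) hsmul
  have ha : ENNReal.ofReal (integerCovolume V) = a := by
    have h := hS (ZSpan.fundamentalDomain b)
    rw [hdom, volume_unitCube, mul_one] at h
    rw [hcov, Measure.real, h]
    simp
  refine ⟨hne, ?_, fun S => ?_⟩
  · rw [hcov]; exact measureReal_nonneg
  · rw [ha]; exact hS S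

lemma ofReal_integerCovolume_ne_zero (r : ℕ) (c : ℝ) :
    ENNReal.ofReal (integerCovolume (sumHyperplane (r + 1) c).direction) ≠ 0 := by
  have h := integerCovolume_direction_ne_zero_and_volume_eq r c
  rw [Ne, ENNReal.ofReal_eq_zero, not_le]
  exact lt_of_le_of_ne h.2.1 h.1.symm

/-- Translation by `p` is an isometry from the direction space onto the hyperplane, which reduces
the claim to volume on the direction. -/
lemma euclideanHausdorffMeasure_sumHyperplane {r : ℕ} {c : ℝ}
    {P : Set (EuclideanSpace ℝ (Fin (r + 1)))} (hP : P ⊆ sumHyperplane (r + 1) c) :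
    μHE[r] P = ENNReal.ofReal (integerCovolume (sumHyperplane (r + 1) c).direction) *
      volume (hyperplanePoint c ⁻¹' P) := by
  let V := (sumHyperplane (r + 1) c).direction
  let p := hyperplanePoint c (0 : Fin r → ℝ)
  let g : V → EuclideanSpace ℝ (Fin (r + 1)) := fun v => (v : EuclideanSpace ℝ (Fin (r + 1))) + p
  have hg : Isometry g := (isometry_add_right p).comp isometry_subtype_coe
  have himage : P = g '' (g ⁻¹' P) := by
    refine (Set.image_preimage_eq_of_subset fun x hx => ?_).symm
    exact ⟨⟨x - p, AffineSubspace.vsub_mem_direction (hP hx) (hyperplanePoint_mem c 0)⟩,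
      sub_add_cancel x p⟩
  have hpre : (directionCoords r c).symm ⁻¹' (g ⁻¹' P) = hyperplanePoint c ⁻¹' P := by
    ext y
    have : g ((directionCoords r c).symm y) = hyperplanePoint c y := by
      ext j
      change hyperplanePoint 0 y j + hyperplanePoint c 0 j = _
      refine Fin.cases ?_ (fun j => ?_) j
      · simp; ring
      · simp
    simp [this]
  have hV : μHE[r] (g ⁻¹' P) = volume (g ⁻¹' P) := by
    have := InnerProductSpace.euclideanHausdorffMeasure_eq_volume (V := V)
    rw [finrank_direction_sumHyperplane] at this
    rw [this]
  conv_lhs => rw [himage]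
  rw [hg.euclideanHausdorffMeasure_image, hV,
    (integerCovolume_direction_ne_zero_and_volume_eq r c).2.2, hpre]

lemma normalizedVolume_sumHyperplane {r : ℕ} {c : ℝ}
    {P : Set (EuclideanSpace ℝ (Fin (r + 1)))} (hP : P ⊆ sumHyperplane (r + 1) c) :
    normalizedVolume (sumHyperplane (r + 1) c) P = r ! * volume (hyperplanePoint c ⁻¹' P) := by
  have h0 := ofReal_integerCovolume_ne_zero r c
  rw [normalizedVolume, finrank_direction_sumHyperplane, euclideanHausdorffMeasure_sumHyperplane hP,
    mul_left_comm, mul_comm]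
  exact ENNReal.mul_div_cancel_right h0 ENNReal.ofReal_ne_top

/-! ### Volume of the hypersimplex -/

lemma volume_affine_eq_zero {r : ℕ} (f : (Fin r → ℝ) →ᵃ[ℝ] ℝ) {t : ℝ} {y₀ : Fin r → ℝ}
    (h : f y₀ ≠ t) : volume {y | f y = t} = 0 := by
  let s : AffineSubspace ℝ (Fin r → ℝ) := (AffineSubspace.mk' t ⊥).comap f
  have hs : (s : Set (Fin r → ℝ)) = {y | f y = t} := by
    ext y
    simp [s, sub_eq_zero]
  rw [← hs]
  refine Measure.addHaar_affineSubspace _ _ fun htop => h ?_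
  have : y₀ ∈ (s : Set (Fin r → ℝ)) := htop ▸ AffineSubspace.mem_top ℝ _ y₀
  rwa [hs] at this

/-- The condition `0 ≤ x_0 ≤ 1` reads `n ≤ ∑ y ≤ n + 1`; the slab and the half-open cube differ from
this only on null boundaries. -/
lemma volume_preimage_hypersimplex (n r : ℕ) :
    volume (hyperplanePoint ((n : ℝ) + 1) ⁻¹' hypersimplex (n + 1) (r + 1)) =
      (eulerianNumber n r : ℝ≥0∞) / (r ! : ℝ≥0∞) := by
  rw [← volume_slab_inter_unitCube]
  refine measure_congr ?_
  let f : (Fin r → ℝ) →ₗ[ℝ] ℝ := ∑ i, LinearMap.proj i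
  have hf (y : Fin r → ℝ) : f y = ∑ i, y i := by simp [f]
  have h1 : ∀ᵐ y : Fin r → ℝ, ∑ i, y i ≠ (n : ℝ) + 1 := by
    have := volume_affine_eq_zero f.toAffineMap (t := (n : ℝ) + 1) (y₀ := 0)
      (by simp only [LinearMap.coe_toAffineMap, map_zero]; positivity)
    rw [ae_iff]
    simpa [hf] using this
  have h2 : unitCube r =ᵐ[volume] Set.Icc (0 : Fin r → ℝ) 1 :=
    Measure.univ_pi_Ico_ae_eq_Icc (f := (0 : Fin r → ℝ)) (g := 1)
  filter_upwards [h1, h2] with y hy hcube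
  have hcube : y ∈ unitCube r ↔ y ∈ Set.Icc (0 : Fin r → ℝ) 1 := iff_of_eq hcube
  refine propext ?_
  change hyperplanePoint ((n : ℝ) + 1) y ∈ hypersimplex (n + 1) (r + 1) ↔
    ⌊∑ i, y i⌋ = n ∧ y ∈ unitCube r
  rw [hcube, Int.floor_eq_iff, Set.mem_Icc, Pi.le_def, Pi.le_def, ← forall_and]
  have hsum := mem_sumHyperplane.1 (hyperplanePoint_mem ((n : ℝ) + 1) y)
  simp only [hypersimplex, Set.mem_ofPred_eq, Fin.forall_fin_succ, hyperplanePoint_zero,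
    hyperplanePoint_succ, hsum, Set.mem_Icc, Pi.zero_apply, Pi.one_apply, Int.cast_natCast]
  push_cast
  constructor
  · rintro ⟨⟨⟨h, h'⟩, h''⟩, -⟩
    exact ⟨⟨by linarith, lt_of_le_of_ne (by linarith) hy⟩, h''⟩
  · rintro ⟨⟨h, h'⟩, h''⟩
    exact ⟨⟨⟨by linarith, by linarith⟩, h''⟩, rfl⟩

lemma normalizedVolume_hypersimplex (n r : ℕ) :
    normalizedVolume (sumHyperplane (r + 1) ((n : ℝ) + 1)) (hypersimplex (n + 1) (r + 1)) =
      (eulerianNumber n r : ℝ≥0∞) := by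
  rw [normalizedVolume_sumHyperplane fun x hx => by simpa using! hx.2,
    volume_preimage_hypersimplex]
  exact ENNReal.mul_div_cancel (by simp [Nat.factorial_ne_zero]) (by simp)

lemma hyperplanePoint_add {r : ℕ} (c : ℝ) (y : Fin r → ℝ) (j : Fin (r + 1)) :
    hyperplanePoint c y j = hyperplanePoint 0 y j + hyperplanePoint c 0 j := by
  refine Fin.cases ?_ (fun j => ?_) j
  · simp; ring
  · simp

lemma exists_hyperplanePoint_eq {r : ℕ} {c : ℝ} {x : EuclideanSpace ℝ (Fin (r + 1))}
    (hx : x ∈ sumHyperplane (r + 1) c) : ∃ y, hyperplanePoint c y = x := by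
  rw [mem_sumHyperplane, Fin.sum_univ_succ] at hx
  refine ⟨fun j => x j.succ, ?_⟩
  ext j
  refine Fin.cases ?_ (fun j => ?_) j
  · simp only [hyperplanePoint_zero]
    linarith
  · simp

/-! ### Cyclic windows: congruence and covering -/

/-- The sum of `m` cyclically consecutive coordinates, starting with the one with number `a`. -/
def windowSum {N : ℕ} [NeZero N] (x : EuclideanSpace ℝ (Fin N)) (a m : ℕ) : ℝ :=
  ∑ s ∈ Finset.range m, x (Fin.ofNat N (a + s))

/-- The points of the hypersimplex `Δ(n+1, N)` whose windows of length `k * t` starting with the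
coordinate with number `a` have sum at most `t`, for `t = 1, …, n`. -/
def windowPolytope (N k n : ℕ) [NeZero N] (a : ℕ) : Set (EuclideanSpace ℝ (Fin N)) :=
  {x | x ∈ hypersimplex (n + 1) N ∧ ∀ t ∈ Finset.Icc 1 n, windowSum x a (k * t) ≤ (t : ℝ)}

section Window

variable {N : ℕ} [NeZero N]

lemma windowSum_add (x : EuclideanSpace ℝ (Fin N)) (a l m : ℕ) :
    windowSum x a (l + m) = windowSum x a l + windowSum x (a + l) m := by
  simp only [windowSum, Finset.sum_range_add, add_assoc]

lemma Fin.ofNat_add_eq (a b : ℕ) : Fin.ofNat N (a + b) = Fin.ofNat N b + Fin.ofNat N a := by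
  ext
  simp [Fin.val_add, add_comm]

lemma windowSum_eq_sum (x : EuclideanSpace ℝ (Fin N)) (a : ℕ) :
    windowSum x a N = ∑ j, x j := by
  rw [← Equiv.sum_comp (Equiv.addRight (Fin.ofNat N a)) (fun j => x j), windowSum,
    ← Fin.sum_univ_eq_sum_range (fun s => x (Fin.ofNat N (a + s)))]
  refine Finset.sum_congr rfl fun j _ => ?_
  have : Fin.ofNat N j = j := Fin.ext (Nat.mod_eq_of_lt j.2)
  rw [Fin.ofNat_add_eq, this]
  rfl

lemma windowSum_add_period (x : EuclideanSpace ℝ (Fin N)) (a m : ℕ) :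
    windowSum x (a + N) m = windowSum x a m := by
  refine Finset.sum_congr rfl fun s _ => ?_
  have : Fin.ofNat N (a + N + s) = Fin.ofNat N (a + s) :=
    Fin.ext (by simp [add_right_comm a N s])
  rw [this]

/-- The cyclic shift of the coordinates by `a`. -/
noncomputable def cyclicShift (N : ℕ) [NeZero N] (a : ℕ) :
    EuclideanSpace ℝ (Fin N) ≃ₗᵢ[ℝ] EuclideanSpace ℝ (Fin N) :=
  LinearIsometryEquiv.piLpCongrLeft 2 ℝ ℝ (Equiv.addRight (Fin.ofNat N a)).symm

lemma cyclicShift_apply (a : ℕ) (x : EuclideanSpace ℝ (Fin N)) (j : Fin N) :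
    cyclicShift N a x j = x (j + Fin.ofNat N a) := rfl

lemma windowPolytope_eq_preimage (k n a : ℕ) :
    windowPolytope N k n a = cyclicShift N a ⁻¹' windowPolytope N k n 0 := by
  ext x
  have h1 : (∀ j, cyclicShift N a x j ∈ Set.Icc (0 : ℝ) 1) ↔ ∀ j, x j ∈ Set.Icc (0 : ℝ) 1 := by
    simp only [cyclicShift_apply]
    exact (Equiv.addRight (Fin.ofNat N a)).forall_congr_left (p := fun j =>
      x (j + Fin.ofNat N a) ∈ Set.Icc (0 : ℝ) 1) |>.trans (by simp)
  have h2 : ∑ j, cyclicShift N a x j = ∑ j, x j :=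
    Equiv.sum_comp (Equiv.addRight (Fin.ofNat N a)) (fun j => x j)
  have h3 (m : ℕ) : windowSum (cyclicShift N a x) 0 m = windowSum x a m := by
    simp only [windowSum, cyclicShift_apply, zero_add, Fin.ofNat_add_eq a]
  simp only [windowPolytope, hypersimplex, Set.mem_preimage, Set.mem_ofPred_eq, h1, h2, h3]

lemma measurableSet_windowPolytope (k n a : ℕ) : MeasurableSet (windowPolytope N k n a) := by
  have : windowPolytope N k n a = ((⋂ j, {x : EuclideanSpace ℝ (Fin N) | x j ∈ Set.Icc (0 : ℝ) 1}) ∩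
      {x : EuclideanSpace ℝ (Fin N) | ∑ j, x j = ((n + 1 : ℕ) : ℝ)}) ∩
      ⋂ t ∈ Finset.Icc 1 n, {x : EuclideanSpace ℝ (Fin N) | windowSum x a (k * t) ≤ (t : ℝ)} := by
    ext x
    simp [windowPolytope, hypersimplex]
  rw [this]
  refine ((MeasurableSet.iInter fun j => ?_).inter ?_).inter
    (MeasurableSet.iInter fun t => MeasurableSet.iInter fun _ => ?_)
  · exact measurableSet_Icc.preimage (by fun_prop)
  · exact measurableSet_eq_fun (by fun_prop) (by fun_prop)
  · unfold windowSum
    exact measurableSet_le (by fun_prop) (by fun_prop)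

lemma euclideanHausdorffMeasure_windowPolytope (d k n a b : ℕ) :
    μHE[d] (windowPolytope N k n a) = μHE[d] (windowPolytope N k n b) := by
  have h (a : ℕ) : μHE[d] (windowPolytope N k n a) = μHE[d] (windowPolytope N k n 0) := by
    rw [windowPolytope_eq_preimage]
    exact ((cyclicShift N a).toIsometryEquiv.measurePreserving_euclideanHausdorffMeasure
      d).measure_preimage (measurableSet_windowPolytope k n 0).nullMeasurableSet
  rw [h a, h b]

/-- Every point of the hypersimplex lies in one of the polytopes: start at a maximum of the
deviations of the prefix sums from their mean. -/
lemma exists_mem_windowPolytope {k n : ℕ} (hN : N = k * (n + 1)) {x : EuclideanSpace ℝ (Fin N)}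
    (hx : x ∈ hypersimplex (n + 1) N) : ∃ i : Fin (n + 1), x ∈ windowPolytope N k n (k * i) := by
  let S : ℕ → ℝ := fun m => windowSum x 0 (k * m) - m
  -- A full turn adds the total `n + 1` to the prefix sum and `n + 1` to the term subtracted.
  have hS : Function.Periodic S (n + 1) := by
    intro m
    have : k * (m + (n + 1)) = N + k * m := by rw [hN]; ring
    simp only [S, this, windowSum_add, windowSum_eq_sum, windowSum_add_period, hx.2]
    push_cast
    ring
  obtain ⟨i, hi, hmax⟩ := (Finset.range (n + 1)).exists_max_image S ⟨0, by simp⟩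
  refine ⟨⟨i, Finset.mem_range.1 hi⟩, hx, fun t _ => ?_⟩
  have h := hmax ((i + t) % (n + 1)) (Finset.mem_range.2 (Nat.mod_lt _ n.succ_pos))
  rw [hS.map_mod_nat] at h
  simp only [S, mul_add k i t, windowSum_add, zero_add] at h
  push_cast at h
  linarith

/-- The window of `k * d` coordinates and its cyclic complement have sums at most `d` and `n + 1 -
d`, while the total is `n + 1`; both bounds are equalities. -/
lemma windowSum_eq_of_mem_of_mem {k n a d : ℕ} (hN : N = k * (n + 1)) (hd : d ∈ Finset.Icc 1 n)
    {x : EuclideanSpace ℝ (Fin N)} (ha : x ∈ windowPolytope N k n a)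
    (hb : x ∈ windowPolytope N k n (a + k * d)) : windowSum x a (k * d) = d := by
  obtain ⟨h1, h2⟩ := Finset.mem_Icc.1 hd
  have e1 := ha.2 d hd
  have e2 := hb.2 (n + 1 - d) (Finset.mem_Icc.2 ⟨by omega, by omega⟩)
  have e3 : windowSum x a (k * d) + windowSum x (a + k * d) (k * (n + 1 - d)) = n + 1 := by
    rw [← windowSum_add, ← mul_add, Nat.add_sub_cancel' (by omega), ← hN, windowSum_eq_sum, ha.1.2]
    push_cast
    rfl
  rw [Nat.cast_sub (by omega)] at e2
  push_cast at e2
  linarith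

end Window

/-! ### Null overlaps and conclusion -/

lemma euclideanHausdorffMeasure_windowSum_eq {r : ℕ} {a m : ℕ} (hm : m < r + 1) {c t : ℝ}
    (ht : t ≠ 0) :
    μHE[r] {x : EuclideanSpace ℝ (Fin (r + 1)) |
      x ∈ sumHyperplane (r + 1) c ∧ windowSum x a m = t} = 0 := by
  rw [euclideanHausdorffMeasure_sumHyperplane fun x hx => hx.1]
  let ℓ : (Fin r → ℝ) →ₗ[ℝ] ℝ := ∑ s ∈ Finset.range m,
    (EuclideanSpace.proj (𝕜 := ℝ) (Fin.ofNat (r + 1) (a + s))).toLinearMap ∘ₗ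
      (sumHyperplane (r + 1) c).direction.subtype ∘ₗ (directionCoords r c).symm.toLinearMap
  let f : (Fin r → ℝ) →ᵃ[ℝ] ℝ :=
    ℓ.toAffineMap + AffineMap.const ℝ _ (windowSum (hyperplanePoint c (0 : Fin r → ℝ)) a m)
  have hf (y : Fin r → ℝ) : f y = windowSum (hyperplanePoint c y) a m := by
    have : ℓ y = windowSum (hyperplanePoint 0 y) a m := by
      simp only [ℓ, LinearMap.sum_apply]
      rfl
    simp only [f, AffineMap.coe_add, Pi.add_apply, LinearMap.coe_toAffineMap,
      AffineMap.const_apply, this, windowSum, ← Finset.sum_add_distrib, ← hyperplanePoint_add]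
  -- As `m < r + 1`, coordinate `a + m` lies outside the window. Putting the whole sum `c` there
  -- gives window sum `0 ≠ t`, so the affine equation is not identically true.
  obtain ⟨y₀, hy₀⟩ := exists_hyperplanePoint_eq
    (x := EuclideanSpace.single (Fin.ofNat (r + 1) (a + m)) c) (c := c)
    (by simp [mem_sumHyperplane])
  have hne : f y₀ ≠ t := by
    rw [hf, hy₀, windowSum, Finset.sum_eq_zero fun s hs => ?_]
    · exact ht.symm
    · have hs := Finset.mem_range.1 hs
      rw [PiLp.single_apply, if_neg]
      intro h
      have h := congrArg Fin.val h
      simp only [Fin.val_ofNat] at h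
      have h := Nat.ModEq.add_left_cancel' a h
      have h := h.eq_of_lt_of_lt (by omega) (by omega)
      omega
  have hset : hyperplanePoint c ⁻¹' {x : EuclideanSpace ℝ (Fin (r + 1)) |
      x ∈ sumHyperplane (r + 1) c ∧ windowSum x a m = t} = {y | f y = t} := by
    ext y
    simp [hf, hyperplanePoint_mem]
  rw [hset, volume_affine_eq_zero f hne, mul_zero]

lemma hypersimplex_subset {r n : ℕ} :
    hypersimplex (n + 1) (r + 1) ⊆ sumHyperplane (r + 1) ((n : ℝ) + 1) :=
  fun x hx => by simpa using! hx.2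

lemma aedisjoint_windowPolytope {r k n a d : ℕ} (hN : r + 1 = k * (n + 1))
    (hd : d ∈ Finset.Icc 1 n) :
    AEDisjoint (μHE[r]) (windowPolytope (r + 1) k n a)
      (windowPolytope (r + 1) k n (a + k * d)) := by
  obtain ⟨h1, h2⟩ := Finset.mem_Icc.1 hd
  have hk : 0 < k := Nat.pos_of_ne_zero fun h => by simp [h] at hN
  have hm : k * d < r + 1 := by
    rw [hN]
    exact Nat.mul_lt_mul_of_pos_left (by omega) hk
  refine measure_mono_null (fun x hx => ?_) (euclideanHausdorffMeasure_windowSum_eq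
    (a := a) hm (c := (n : ℝ) + 1) (t := d) (by simp; omega))
  exact ⟨hypersimplex_subset hx.1.1, windowSum_eq_of_mem_of_mem hN hd hx.1 hx.2⟩

lemma euclideanHausdorffMeasure_hypersimplex {r k n : ℕ} (hN : r + 1 = k * (n + 1)) (a : ℕ) :
    μHE[r] (hypersimplex (n + 1) (r + 1)) =
      ((n : ℝ≥0∞) + 1) * μHE[r] (windowPolytope (r + 1) k n a) := by
  have hU : hypersimplex (n + 1) (r + 1) =
      ⋃ i : Fin (n + 1), windowPolytope (r + 1) k n (k * i) := by
    ext x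
    rw [Set.mem_iUnion]
    exact ⟨exists_mem_windowPolytope hN, fun ⟨_, hx⟩ => hx.1⟩
  have hlt (i j : Fin (n + 1)) (hij : i < j) : AEDisjoint (μHE[r])
      (windowPolytope (r + 1) k n (k * i)) (windowPolytope (r + 1) k n (k * j)) := by
    have hij := Fin.lt_def.1 hij
    have := aedisjoint_windowPolytope (a := k * i) (d := j - i) hN
      (Finset.mem_Icc.2 ⟨by omega, by omega⟩)
    rwa [← mul_add, Nat.add_sub_cancel' hij.le] at this
  have hdisj : Pairwise (Function.onFun (AEDisjoint (μHE[r]))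
      fun i : Fin (n + 1) => windowPolytope (r + 1) k n (k * i)) := by
    intro i j hij
    rcases lt_or_gt_of_ne hij with h | h
    · exact hlt i j h
    · exact (hlt j i h).symm
  rw [hU, measure_iUnion₀ hdisj fun i => (measurableSet_windowPolytope k n _).nullMeasurableSet,
    tsum_fintype]
  simp [euclideanHausdorffMeasure_windowPolytope (N := r + 1) r k n _ a]

lemma normalizedVolume_windowPolytope {N k n : ℕ} [NeZero N] (hN : N = k * (n + 1)) (a : ℕ) :
    normalizedVolume (sumHyperplane N ((n : ℝ) + 1)) (windowPolytope N k n a) =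
      (eulerianNumber n (N - 1) : ℝ≥0∞) / ((n : ℝ≥0∞) + 1) := by
  obtain _ | r := N
  · exact (NeZero.ne 0 rfl).elim
  have h := normalizedVolume_hypersimplex n r
  rw [normalizedVolume, finrank_direction_sumHyperplane,
    euclideanHausdorffMeasure_hypersimplex hN a, mul_left_comm, mul_div_assoc] at h
  rw [normalizedVolume, finrank_direction_sumHyperplane, Nat.add_sub_cancel, ← h, mul_comm]
  rw [mul_comm ((n : ℝ≥0∞) + 1), ENNReal.mul_div_cancel_right (by simp) (by finiteness), mul_comm]

theorem mainTheorem3 (k n : ℕ) [NeZero k] (i : Fin (n + 1)) :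
    normalizedVolume (sumHyperplane (k * (n + 1)) ((n : ℝ) + 1)) (shiftedPolytope k n i) =
      (eulerianNumber n (k * n + k - 1) : ℝ≥0∞) / ((n : ℝ≥0∞) + 1) :=
  -- Definitionally, `shiftedPolytope k n i` is the window polytope starting at `k * i`, and `k * (n
  -- + 1)` is `k * n + k`.
  normalizedVolume_windowPolytope rfl (k * i)
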